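/- Let $G$ be an $r$-dimensional Lie group acting smoothly on an $m$-dimensional smooth manifold $M$, and diagonally on $M^{k}$. Let $\mathbb Z_k$ act on $M^{k}$ by cyclic permutations of the $k$ points, and let $\mathbb H_k$ be the group generated by $\mathbb Z_k$ and the reversal $(p_1,\dots,p_k)\mapsto(p_k,\dots,p_1)$. Write $[p]=[p_1,\dots,p_k]$ for the class of $p\in M^k$ in $M^k/\mathbb Z_k$ and $\langle p\rangle=\langle p_1,\dots,p_k\rangle$ for its class in $M^k/\mathbb H_k$; the points of $M^k/\mathbb H_k$ are called $k$-gons, and two $k$-gons $P,Q$ are $G$-equivalent, $P\equiv Q \bmod G$, if $g\cdot P=Q$ for some $g\in G$. Suppose that $G$ acts regularly with $s$-dimensional orbits on an open set $U\subset M^k$: all orbits through points of $U$ have dimension $s$, and every point of $U$ has arbitrarily small neighborhoods whose intersection with its own orbit is connected. For a subgroup $\Gamma\subset\mathbb H_k$, a complete fundamental set of $(G\times\Gamma)$-invariants on an open set $V\subset M^k$ consists of $mk-s$ smooth functions $V\to\mathbb R$ that are unchanged under $G\times\Gamma$ (as functions on $V$), are functionally independent (linearly independent differentials at every point of $V$),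 and are such that every other smooth $(G\times\Gamma)$-invariant defined near a point of $V$ is, near that point, a function of them. Let $z\in U$, and let $S_M:V_M\to\mathbb R^{mk-s}$, $S_{\mathfrak M}:V_{\mathfrak M}\to\mathbb R^{mk-s}$ and $S_{\mathcal P}:V_{\mathcal P}\to\mathbb R^{mk-s}$ be defined on open neighborhoods of $z$ in $M^k$, of $[z]$ in $M^k/\mathbb Z_k$ and of $\langle z\rangle$ in $M^k/\mathbb H_k$, such that the components of $S_M$, of $p\mapsto S_{\mathfrak M}([p])$ and of $p\mapsto S_{\mathcal P}(\langle p\rangle)$ are complete fundamental sets of $G$-, $(G\times\mathbb Z_k)$- and $(G\times\mathbb H_k)$-invariants respectively, each on the corresponding open subset of $M^k$. Then $z$ has an open neighborhood $W\subset U$, contained together with its images in the domains $V_M,V_{\mathfrak M},V_{\mathcal P}$, such that the following holds for all domains $U_M\subset W$, $U_{\mathfrak M}\subset\{[w]:w\in W\}$, $U_{\mathcal P}\subset\{\langle w\rangle:w\in W\}$. Let $P=\langle p_1,\dots,p_k\rangle$ and $Q=\langle q_1,\dots,q_k\rangle$ be $k$-gons with $(p_1,\dots,p_k)\in U_M$,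 $[p_1,\dots,p_k]\in U_{\mathfrak M}$, $P\in U_{\mathcal P}$, and such that $h\cdot(q_1,\dots,q_k)\in U_M$ for some $h\in\mathbb H_k$, at least one of $[q_1,\dots,q_k]$, $[q_k,\dots,q_1]$ is in $U_{\mathfrak M}$, and $Q\in U_{\mathcal P}$. Then the following are equivalent: 1. $P\equiv Q\bmod G$; 2. there is $h\in\mathbb H_k$ with $h\cdot(q_1,\dots,q_k)\in U_M$ and $S_M(p_1,\dots,p_k)=S_M(h\cdot(q_1,\dots,q_k))$; 3. $[q_1,\dots,q_k]\in U_{\mathfrak M}$ and $S_{\mathfrak M}([p_1,\dots,p_k])=S_{\mathfrak M}([q_1,\dots,q_k])$, or $[q_k,\dots,q_1]\in U_{\mathfrak M}$ and $S_{\mathfrak M}([p_1,\dots,p_k])=S_{\mathfrak M}([q_k,\dots,q_1])$; 4. $S_{\mathcal P}(\langle p_1,\dots,p_k\rangle)=S_{\mathcal P}(\langle q_1,\dots,q_k\rangle)$. -/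

import Mathlib

open Set Topology Manifold
open scoped ContDiff

/-! ### Tuples of points, cyclic and dihedral permutations, polygons -/

/-- The group `Z_k` of cyclic permutations of the `k` positions. -/
def cyclicPerms (k : ℕ) : Subgroup (Equiv.Perm (Fin k)) :=
  Subgroup.zpowers (finRotate k)

/-- The group `H_k` generated by the cyclic permutations and the reversal of the order. -/
def polygonPerms (k : ℕ) : Subgroup (Equiv.Perm (Fin k)) :=
  cyclicPerms k ⊔ Subgroup.zpowers Fin.revPerm

/-- The (left) action of a permutation of the positions on `k`-tuples of points. -/
def permute {k : ℕ} {M : Type*} (h : Equiv.Perm (Fin k)) (p : Fin k → M) : Fin k → M :=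
  fun i => p (h⁻¹ i)

/-- The tuple `(p_k, …, p_2, p_1)`. -/
def reverseTuple {k : ℕ} {M : Type*} (p : Fin k → M) : Fin k → M :=
  permute Fin.revPerm p

/-- Two `k`-tuples are identified when a permutation in `Γ` carries one to the other. -/
def permSetoid {k : ℕ} (Γ : Subgroup (Equiv.Perm (Fin k))) (M : Type*) :
    Setoid (Fin k → M) where
  r p q := ∃ h ∈ Γ, permute h p = q
  iseqv :=
    { refl := fun p => ⟨1, Γ.one_mem, by funext i; simp [permute]⟩
      symm := by
        rintro p _ ⟨h, hh, rfl⟩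
        exact ⟨h⁻¹, Γ.inv_mem hh, by funext i; simp [permute]⟩
      trans := by
        rintro p _ _ ⟨h, hh, rfl⟩ ⟨h', hh', rfl⟩
        exact ⟨h' * h, Γ.mul_mem hh' hh, by funext i; simp [permute]⟩ }

/-- The quotient of the set of `k`-tuples of points of `M` by the permutations in `Γ`. -/
def TupleQuot {k : ℕ} (Γ : Subgroup (Equiv.Perm (Fin k))) (M : Type*) : Type _ :=
  Quotient (permSetoid Γ M)

/-- The class of a tuple. -/
def TupleQuot.mk {k : ℕ} (Γ : Subgroup (Equiv.Perm (Fin k))) {M : Type*} (p : Fin k → M) :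
    TupleQuot Γ M :=
  Quotient.mk (permSetoid Γ M) p

/-- The quotient topology. -/
instance TupleQuot.instTopologicalSpace {k : ℕ} (Γ : Subgroup (Equiv.Perm (Fin k)))
    (M : Type*) [TopologicalSpace M] : TopologicalSpace (TupleQuot Γ M) :=
  inferInstanceAs (TopologicalSpace (Quotient (permSetoid Γ M)))

/-- The action induced on the quotient by the diagonal action of `G` on tuples. -/
instance TupleQuot.instSMul {k : ℕ} (Γ : Subgroup (Equiv.Perm (Fin k))) (M : Type*)
    {G : Type*} [SMul G M] : SMul G (TupleQuot Γ M) where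
  smul g := Quotient.map' (s₁ := permSetoid Γ M) (s₂ := permSetoid Γ M) (fun p => g • p) (by
    rintro p _ ⟨h, hh, rfl⟩
    exact ⟨h, hh, rfl⟩)

/-- `k`-tuples modulo cyclic permutations. -/
abbrev CyclicTuple (k : ℕ) (M : Type*) : Type _ := TupleQuot (cyclicPerms k) M

/-- `k`-vertex polygons (`k`-gons): `k`-tuples modulo `H_k`. -/
abbrev KGon (k : ℕ) (M : Type*) : Type _ := TupleQuot (polygonPerms k) M

/-- The class `[p_1, …, p_k]` of a tuple modulo cyclic permutations. -/
abbrev cyclicTuple {k : ℕ} {M : Type*} (p : Fin k → M) : CyclicTuple k M :=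
  TupleQuot.mk (cyclicPerms k) p

/-- The `k`-gon `⟨p_1, …, p_k⟩`. -/
abbrev polygon {k : ℕ} {M : Type*} (p : Fin k → M) : KGon k M :=
  TupleQuot.mk (polygonPerms k) p

/-- Two `k`-gons are equivalent under `G` if some element of `G` carries one to the other. -/
def PolygonEquiv (G : Type*) {k : ℕ} {M : Type*} [SMul G M] (P Q : KGon k M) : Prop :=
  ∃ g : G, g • P = Q

/-! ### The product manifold, orbits and invariants -/

/-- The model with corners of the product manifold `M × ⋯ × M` (`k` factors), `dim M = m`. -/
noncomputable abbrev tupleModel (m k : ℕ) :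
    ModelWithCorners ℝ (Fin k → EuclideanSpace ℝ (Fin m))
      (ModelPi fun _ : Fin k => EuclideanSpace ℝ (Fin m)) :=
  ModelWithCorners.pi fun _ : Fin k => 𝓡 m


/-- The dimension of the orbit of `G` through the tuple `p`: the rank at `1` of the orbit map
`g ↦ g • p`. -/
noncomputable def orbitDim (m r : ℕ) {k : ℕ} {M : Type*} [TopologicalSpace M]
    [ChartedSpace (EuclideanSpace ℝ (Fin m)) M] (G : Type*) [TopologicalSpace G]
    [ChartedSpace (EuclideanSpace ℝ (Fin r)) G] [Group G] [MulAction G M]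
    (p : Fin k → M) : ℕ :=
  Module.finrank ℝ
    (LinearMap.range (mfderiv (𝓡 r) (tupleModel m k) (fun g : G => g • p) 1).toLinearMap)

/-- `G` acts regularly on the set `U` of `k`-tuples, with `s`-dimensional orbits: all orbits
through points of `U` have dimension `s`, and every point of `U` has arbitrarily small
neighborhoods whose intersection with the orbit through that point is connected. -/
structure ActsRegularly (m r : ℕ) {k : ℕ} {M : Type*} [TopologicalSpace M]
    [ChartedSpace (EuclideanSpace ℝ (Fin m)) M] (G : Type*) [TopologicalSpace G]
    [ChartedSpace (EuclideanSpace ℝ (Fin r)) G] [Group G] [MulAction G M]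
    (U : Set (Fin k → M)) (s : ℕ) : Prop where
  orbitDim_eq : ∀ p ∈ U, orbitDim m r G p = s
  connected : ∀ p ∈ U, ∀ O ∈ 𝓝 p, ∃ O' ∈ 𝓝 p, O' ⊆ O ∧
    IsConnected (O' ∩ MulAction.orbit G p)

/-- The differential at `p` of a real-valued function of `k`-tuples, as a linear form. -/
noncomputable def tupleDifferential (m : ℕ) {k : ℕ} {M : Type*} [TopologicalSpace M]
    [ChartedSpace (EuclideanSpace ℝ (Fin m)) M] (J : (Fin k → M) → ℝ) (p : Fin k → M) :
    TangentSpace (tupleModel m k) p →L[ℝ] ℝ :=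
  mfderiv (tupleModel m k) 𝓘(ℝ, ℝ) J p

/-- `J` is unchanged under the action of `G × Γ`, as a function defined on `V`. -/
def IsInvariantOn {k : ℕ} {M : Type*} (G : Type*) [SMul G M]
    (Γ : Subgroup (Equiv.Perm (Fin k))) (V : Set (Fin k → M)) (J : (Fin k → M) → ℝ) : Prop :=
  ∀ g : G, ∀ h ∈ Γ, ∀ p ∈ V, g • permute h p ∈ V → J (g • permute h p) = J p

/-- `J_1, …, J_N` is a complete fundamental set of `G × Γ`-invariants on the open set `V` of
`k`-tuples: smooth, invariant, functionally independent (their differentials are linearly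
independent at each point), and such that every other smooth invariant defined near a point of
`V` is, near that point, a function of `J_1, …, J_N`.
That they separate orbits is not part of the definition. -/
structure IsCompleteFundamentalSet (m : ℕ) {k : ℕ} {M : Type*} [TopologicalSpace M]
    [ChartedSpace (EuclideanSpace ℝ (Fin m)) M] (G : Type*) [SMul G M]
    (Γ : Subgroup (Equiv.Perm (Fin k))) (V : Set (Fin k → M)) {N : ℕ}
    (J : Fin N → (Fin k → M) → ℝ) : Prop where
  isOpen : IsOpen V
  smooth : ∀ i, ContMDiffOn (tupleModel m k) 𝓘(ℝ, ℝ) ∞ (J i) V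
  invariant : ∀ i, IsInvariantOn G Γ V (J i)
  independent : ∀ p ∈ V, LinearIndependent ℝ fun i : Fin N =>
    tupleDifferential m (J i) p
  generating : ∀ p ∈ V, ∀ O : Set (Fin k → M), IsOpen O → p ∈ O →
    ∀ F : (Fin k → M) → ℝ, ContMDiffOn (tupleModel m k) 𝓘(ℝ, ℝ) ∞ F O →
      IsInvariantOn G Γ O F →
      ∃ O' ⊆ O ∩ V, IsOpen O' ∧ p ∈ O' ∧
        ∃ f : (Fin N → ℝ) → ℝ, ∀ x ∈ O', F x = f fun i => J i x

/-! ### Level sets of submersions -/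

section NormedSpace

variable {E F R : Type*} [NormedAddCommGroup E] [NormedSpace ℝ E] [FiniteDimensional ℝ E]
  [NormedAddCommGroup F] [NormedSpace ℝ F] [FiniteDimensional ℝ F]
  [NormedAddCommGroup R] [NormedSpace ℝ R] [FiniteDimensional ℝ R]

/-! Functional independence makes a signature `S` with `mk - s` components a submersion, so its
level sets have dimension `s`, the dimension of the orbits. Invariance puts each orbit, near any of
its points, inside a level set; the equal dimensions make it a neighborhood of that point in the
level set (`HasStrictFDerivAt.eventually_mem_image_of_eq`). On a small neighborhood of `z` whose
level slices are connected, the orbits cut each slice into relatively open pieces, so a slice lies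
in a single orbit: equal signatures imply the same `G`-orbit
(`IsCompleteFundamentalSet.exists_mem_orbit_of_eq`).

This argument serves all three symmetry groups and always gives a `G`-orbit, with no permutation
left over. `W` is the intersection of the three neighborhoods. If `P ≡ Q` and `w ∈ W` represents
`Q`, then `p` and `w` a priori agree only up to `G` and a permutation. The polygon signature does
not see the permutation, so it agrees at `p` and `w`, and its separation property on `W` puts them
in one `G`-orbit. Hence the other two signatures agree there too. -/

/-- A point where `f` is a submersion has arbitrarily small neighborhoods whose intersections with
the level sets of `f` are connected. -/
theorem HasStrictFDerivAt.exists_isPreconnected_levelSet {f : E → F} {f' : E →L[ℝ] F} {a : E}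
    (hf : HasStrictFDerivAt f f' a) (hf' : f'.range = ⊤) {O : Set E} (hO : O ∈ 𝓝 a) :
    ∃ W ⊆ O, IsOpen W ∧ a ∈ W ∧ ∀ c, IsPreconnected (W ∩ f ⁻¹' {c}) := by
  have := FiniteDimensional.complete ℝ E
  have := FiniteDimensional.complete ℝ F
  set e := hf.implicitToOpenPartialHomeomorph f f' hf'
  have ha : a ∈ e.source := hf.mem_implicitToOpenPartialHomeomorph_source hf'
  have hfst : ∀ x, (e x).1 = f x := fun x => rfl
  have hN : e.target ∩ e.symm ⁻¹' O ∈ 𝓝 (e a) := by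
    refine Filter.inter_mem (e.open_target.mem_nhds (e.map_source ha)) ?_
    refine (e.continuousAt_symm (e.map_source ha)).preimage_mem_nhds ?_
    rwa [e.left_inv ha]
  obtain ⟨ε, hε, hball⟩ := Metric.mem_nhds_iff.1 hN
  have himage : e.symm '' Metric.ball (e a) ε = e.source ∩ e ⁻¹' Metric.ball (e a) ε :=
    e.symm.image_eq_target_inter_inv_preimage fun y hy => (hball hy).1
  refine ⟨e.symm '' Metric.ball (e a) ε, ?_, ?_, ⟨e a, Metric.mem_ball_self hε, e.left_inv ha⟩, ?_⟩
  · rintro _ ⟨y, hy, rfl⟩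
    exact (hball hy).2
  · rw [himage]
    exact e.isOpen_inter_preimage Metric.isOpen_ball
  · intro c
    -- In the straightening chart `e` the first coordinate is `f`, so a level set becomes a slice of
    -- a ball, which is convex.
    have hlevel : e.symm '' Metric.ball (e a) ε ∩ f ⁻¹' {c}
        = e.symm '' (Metric.ball (e a) ε ∩ Prod.fst ⁻¹' {c}) := by
      ext x
      constructor
      · rintro ⟨⟨y, hy, rfl⟩, hx⟩
        refine ⟨y, ⟨hy, ?_⟩, rfl⟩
        have : f (e.symm y) = c := hx
        rwa [← hfst, e.right_inv (hball hy).1] at this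
      · rintro ⟨y, ⟨hy, hyc⟩, rfl⟩
        refine ⟨⟨y, hy, rfl⟩, ?_⟩
        change f (e.symm y) = c
        rw [← hfst, e.right_inv (hball hy).1]
        exact hyc
    rw [hlevel]
    refine IsPreconnected.image ?_ _ (e.continuousOn_symm.mono fun y hy => (hball hy.1).1)
    refine Convex.isPreconnected ((convex_ball _ _).inter ?_)
    exact (convex_singleton c).is_linear_preimage (LinearMap.fst ℝ F f'.ker).isLinear

/-- If `φ` maps into the level set through `φ r` of a submersion `f`, and the rank of `φ` at `r` is
the dimension of the level set, then the range of `φ` is a neighborhood of `φ r` in that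
level set. -/
theorem HasStrictFDerivAt.eventually_mem_image_of_eq {f : E → F} {f' : E →L[ℝ] F} {φ : R → E}
    {φ' : R →L[ℝ] E} {r : R} (hf : HasStrictFDerivAt f f' (φ r)) (hf' : f'.range = ⊤)
    (hφ : HasStrictFDerivAt φ φ' r) (hlevel : ∀ᶠ t in 𝓝 r, f (φ t) = f (φ r))
    (hdim : Module.finrank ℝ φ'.range + Module.finrank ℝ F = Module.finrank ℝ E)
    {T : Set R} (hT : T ∈ 𝓝 r) : ∀ᶠ x in 𝓝 (φ r), f x = f (φ r) → x ∈ φ '' T := by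
  have := FiniteDimensional.complete ℝ E
  have := FiniteDimensional.complete ℝ F
  have := FiniteDimensional.complete ℝ R
  -- `f ∘ φ` is locally constant, so the range of `φ'` lies in the kernel of `f'`; the rank
  -- hypothesis makes them equal.
  have hcomp : f' ∘L φ' = 0 :=
    ((hf.comp r hφ).hasFDerivAt.congr_of_eventuallyEq
      (hlevel.mono fun t ht => ht.symm)).unique (hasFDerivAt_const (f (φ r)) r)
  have hle : φ'.range ≤ f'.ker := by
    rintro _ ⟨v, rfl⟩
    exact congrArg (fun A : R →L[ℝ] F => A v) hcomp
  have hrange : φ'.range = f'.ker := by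
    refine Submodule.eq_of_le_of_finrank_eq hle ?_
    have h := LinearMap.finrank_range_add_finrank_ker f'.toLinearMap
    have h' : Module.finrank ℝ f'.range = Module.finrank ℝ F := by rw [hf', finrank_top]
    omega
  obtain ⟨P, hP⟩ := Submodule.ClosedComplemented.of_finiteDimensional f'.ker
  -- The chart is `(f, P)` with `P` an explicit linear projection onto the kernel, so that `P ∘ φ`
  -- has the surjective derivative `P ∘ φ'` and is open at `r`. A nearby `x` on the level set then
  -- shares both coordinates with some `φ t`.
  let D : ImplicitFunctionData ℝ E F f'.ker :=
    { leftFun := f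
      leftDeriv := f'
      rightFun := P
      rightDeriv := P
      pt := φ r
      hasStrictFDerivAt_leftFun := hf
      hasStrictFDerivAt_rightFun := P.hasStrictFDerivAt
      range_leftDeriv := hf'
      range_rightDeriv := LinearMap.range_eq_of_proj hP
      isCompl_ker := LinearMap.isCompl_of_proj hP }
  set e := D.toOpenPartialHomeomorph
  have hsource : e.source ∈ 𝓝 (φ r) :=
    e.open_source.mem_nhds D.pt_mem_toOpenPartialHomeomorph_source
  have hsurj : (P ∘L φ').range = ⊤ := by
    refine eq_top_iff.2 fun v _ => ?_
    obtain ⟨w, hw⟩ : (v : E) ∈ φ'.range := by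
      rw [hrange]
      exact v.2
    refine ⟨w, ?_⟩
    change P (φ' w) = v
    rw [show φ' w = v from hw, hP]
  have hopen : Filter.map (P ∘ φ) (𝓝 r) = 𝓝 (P (φ r)) :=
    (P.hasStrictFDerivAt.comp r hφ).map_nhds_eq_of_surj hsurj
  have hgood : T ∩ {t | f (φ t) = f (φ r)} ∩ φ ⁻¹' e.source ∈ 𝓝 r :=
    Filter.inter_mem (Filter.inter_mem hT hlevel)
      (hφ.continuousAt.preimage_mem_nhds hsource)
  have himage := Filter.image_mem_map (m := P ∘ φ) hgood
  rw [hopen] at himage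
  filter_upwards [hsource, P.continuous.continuousAt.preimage_mem_nhds himage] with x hx hPx hfx
  obtain ⟨t, ⟨⟨htT, hft⟩, hte⟩, hPt⟩ := hPx
  refine ⟨t, htT, e.injOn hte hx ?_⟩
  exact Prod.ext (hft.trans hfx.symm) hPt

end NormedSpace

/-! ### Transfer to manifolds through extended charts. -/

section Manifold

variable {E H : Type*} [NormedAddCommGroup E] [NormedSpace ℝ E]
  [TopologicalSpace H] {I : ModelWithCorners ℝ E H} [I.Boundaryless]
  {X : Type*} [TopologicalSpace X] [ChartedSpace H X]
  {E' H' : Type*} [NormedAddCommGroup E'] [NormedSpace ℝ E'] [TopologicalSpace H']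
  {I' : ModelWithCorners ℝ E' H'} {Y : Type*} [TopologicalSpace Y] [ChartedSpace H' Y]
  {F : Type*} [NormedAddCommGroup F] [NormedSpace ℝ F]

/-- Without boundary the chart expression is smooth on a full neighborhood, and `mfderiv` is by
definition its derivative. -/
theorem ContMDiffAt.hasStrictFDerivAt_writtenInExtChartAt {f : X → Y} {x : X}
    (hf : ContMDiffAt I I' ∞ f x) :
    HasStrictFDerivAt (writtenInExtChartAt I I' x f)
      (mfderiv I I' f x : E →L[ℝ] E') (extChartAt I x x) := by
  have h := (contMDiffAt_iff.1 hf).2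
  rw [I.range_eq_univ, contDiffWithinAt_univ] at h
  have hderiv : (mfderiv I I' f x : E →L[ℝ] E')
      = fderiv ℝ (writtenInExtChartAt I I' x f) (extChartAt I x x) := by
    rw [← fderivWithin_univ, ← I.range_eq_univ]
    exact if_pos (hf.mdifferentiableAt (by simp))
  exact hderiv ▸ h.hasStrictFDerivAt (by simp)

theorem exists_isPreconnected_levelSet [FiniteDimensional ℝ E] [FiniteDimensional ℝ F]
    {S : X → F} {S' : E →L[ℝ] F} {x : X}
    (hS : HasStrictFDerivAt (S ∘ (extChartAt I x).symm) S' (extChartAt I x x))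
    (hS' : S'.range = ⊤) {O : Set X} (hO : O ∈ 𝓝 x) :
    ∃ W ⊆ O, IsOpen W ∧ x ∈ W ∧ ∀ c, IsPreconnected (W ∩ S ⁻¹' {c}) := by
  obtain ⟨W, hWsub, hWo, hxW, hW⟩ := hS.exists_isPreconnected_levelSet hS'
    (Filter.inter_mem (extChartAt_target_mem_nhds x) (extChartAt_preimage_mem_nhds hO))
  have hWt : W ⊆ (extChartAt I x).target := hWsub.trans inter_subset_left
  have hsymm : ∀ y ∈ W, extChartAt I x ((extChartAt I x).symm y) = y := fun y hy =>
    (extChartAt I x).right_inv (hWt hy)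
  refine ⟨(extChartAt I x).source ∩ extChartAt I x ⁻¹' W, fun y hy =>
    (extChartAt I x).left_inv hy.1 ▸ (hWsub hy.2).2,
    isOpen_extChartAt_preimage' x hWo, ⟨mem_extChartAt_source x, hxW⟩, fun c => ?_⟩
  have : (extChartAt I x).source ∩ extChartAt I x ⁻¹' W ∩ S ⁻¹' {c}
      = (extChartAt I x).symm '' (W ∩ (S ∘ (extChartAt I x).symm) ⁻¹' {c}) := by
    ext y
    constructor
    · rintro ⟨⟨hy, hyW⟩, hyc⟩
      have hinv := (extChartAt I x).left_inv hy
      refine ⟨extChartAt I x y, ⟨hyW, ?_⟩, hinv⟩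
      change S ((extChartAt I x).symm (extChartAt I x y)) = c
      rw [hinv]
      exact hyc
    · rintro ⟨u, ⟨hu, huc⟩, rfl⟩
      refine ⟨⟨(extChartAt I x).map_target (hWt hu), ?_⟩, huc⟩
      rwa [mem_preimage, hsymm u hu]
  rw [this]
  exact (hW c).image _ ((continuousOn_extChartAt_symm x).mono fun y hy => hWt hy.1)

theorem ContMDiffAt.eventually_mem_range_of_eq {I' : ModelWithCorners ℝ E' H'} [I'.Boundaryless]
    [FiniteDimensional ℝ E] [FiniteDimensional ℝ E'] [FiniteDimensional ℝ F]
    {φ : X → Y} {x : X} {S : Y → F} {S' : E' →L[ℝ] F} (hφ : ContMDiffAt I I' ∞ φ x)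
    (hS : HasStrictFDerivAt (S ∘ (extChartAt I' (φ x)).symm) S' (extChartAt I' (φ x) (φ x)))
    (hS' : S'.range = ⊤) (hlevel : ∀ᶠ t in 𝓝 x, S (φ t) = S (φ x))
    (hdim : Module.finrank ℝ (LinearMap.range (mfderiv I I' φ x).toLinearMap)
      + Module.finrank ℝ F = Module.finrank ℝ E') :
    ∀ᶠ y in 𝓝 (φ x), S y = S (φ x) → y ∈ range φ := by
  set ψ : E → E' := writtenInExtChartAt I I' x φ
  have hψ : HasStrictFDerivAt ψ (mfderiv I I' φ x : E →L[ℝ] E') (extChartAt I x x) :=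
    hφ.hasStrictFDerivAt_writtenInExtChartAt
  have hψx : ψ (extChartAt I x x) = extChartAt I' (φ x) (φ x) := by
    simp [ψ, writtenInExtChartAt]
  have hsymm : Filter.Tendsto (extChartAt I x).symm (𝓝 (extChartAt I x x)) (𝓝 x) := by
    simpa [ContinuousAt] using continuousAt_extChartAt_symm (I := I) x
  have hsource : ∀ᶠ t in 𝓝 x, φ t ∈ (extChartAt I' (φ x)).source :=
    hφ.continuousAt.preimage_mem_nhds (extChartAt_source_mem_nhds (φ x))
  have hlevel' : ∀ᶠ u in 𝓝 (extChartAt I x x), (S ∘ (extChartAt I' (φ x)).symm) (ψ u)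
      = (S ∘ (extChartAt I' (φ x)).symm) (ψ (extChartAt I x x)) := by
    filter_upwards [hsymm.eventually (hlevel.and hsource)] with u hu
    rw [hψx]
    change S ((extChartAt I' (φ x)).symm (extChartAt I' (φ x) (φ ((extChartAt I x).symm u)))) = _
    rw [(extChartAt I' (φ x)).left_inv hu.2, hu.1, Function.comp_apply, extChartAt_to_inv]
  have key := (hψx.symm ▸ hS).eventually_mem_image_of_eq hS' hψ hlevel' hdim
    (hsymm.eventually hsource)
  rw [hψx] at key
  filter_upwards [(continuousAt_extChartAt (I := I') (φ x)).eventually key,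
    extChartAt_source_mem_nhds (I := I') (φ x)] with y hy hys hSy
  obtain ⟨u, hu, hψu⟩ := hy <| by
    rw [Function.comp_apply, (extChartAt I' (φ x)).left_inv hys, hSy, Function.comp_apply,
      extChartAt_to_inv]
  exact ⟨(extChartAt I x).symm u, (extChartAt I' (φ x)).injOn hu hys hψu⟩

end Manifold

/-- Linearly independent linear forms are jointly surjective. -/
theorem LinearIndependent.range_pi_eq_top {E : Type*} [NormedAddCommGroup E] [NormedSpace ℝ E]
    {N : ℕ} {f : Fin N → E →L[ℝ] ℝ} (hf : LinearIndependent ℝ f) :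
    (ContinuousLinearMap.pi f).range = ⊤ := by
  have h : LinearIndependent ℝ fun i x => f i x :=
    hf.map' ((LinearMap.ltoFun ℝ E ℝ ℝ) ∘ₗ ContinuousLinearMap.coeLM ℝ) <|
      LinearMap.ker_eq_bot.2 fun _ _ h => ContinuousLinearMap.ext fun x => congrFun h x
  -- Independence of the `f i` means that the vectors `(f i x)_i` span; these vectors already form
  -- the range, a subspace.
  rw [eq_top_iff, ← span_flip_eq_top_iff_linearIndependent.2 h, Submodule.span_le]
  rintro _ ⟨x, rfl⟩
  exact ⟨x, rfl⟩

/-! ### Orbits in the manifold of tuples and level sets of invariants -/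

instance tupleModel_boundaryless (m k : ℕ) : (tupleModel m k).Boundaryless where
  range_eq_univ := range_eq_univ.2 fun x => ⟨x, rfl⟩

section Tuples

variable {m r k s N : ℕ} {M : Type*} [TopologicalSpace M]
  [ChartedSpace (EuclideanSpace ℝ (Fin m)) M]
  {G : Type*}

theorem contMDiff_tuple [TopologicalSpace G] [ChartedSpace (EuclideanSpace ℝ (Fin r)) G]
    {f : G → Fin k → M}
    (hf : ∀ i, ContMDiff (𝓡 r) (𝓡 m) ∞ fun g => f g i) :
    ContMDiff (𝓡 r) (tupleModel m k) ∞ f := fun g =>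
  contMDiffAt_iff.2 ⟨continuousAt_pi.2 fun i => (hf i g).continuousAt,
    contDiffWithinAt_pi.2 fun i => (contMDiffAt_iff.1 (hf i g)).2⟩

variable [Group G] [MulAction G M]

theorem contMDiff_orbitMap [TopologicalSpace G] [ChartedSpace (EuclideanSpace ℝ (Fin r)) G]
    [ContMDiffSMul (𝓡 r) (𝓡 m) ∞ G M] (p : Fin k → M) :
    ContMDiff (𝓡 r) (tupleModel m k) ∞ fun g : G => g • p :=
  contMDiff_tuple fun i =>
    (ContMDiffSMul.contMDiff_smul (I := 𝓡 r) (I' := 𝓡 m) (G := G) (M := M)).comp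
      (contMDiff_id.prodMk (contMDiff_const (c := p i)))

variable {Γ : Subgroup (Equiv.Perm (Fin k))} {V : Set (Fin k → M)} {S : (Fin k → M) → Fin N → ℝ}

namespace IsCompleteFundamentalSet

/-- Functional independence in the form used here: the signature is a submersion in a chart. -/
theorem hasStrictFDerivAt (hS : IsCompleteFundamentalSet m G Γ V fun i p => S p i)
    {p : Fin k → M} (hp : p ∈ V) :
    ∃ S' : (Fin k → EuclideanSpace ℝ (Fin m)) →L[ℝ] (Fin N → ℝ), S'.range = ⊤ ∧
      HasStrictFDerivAt (S ∘ (extChartAt (tupleModel m k) p).symm) S'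
        (extChartAt (tupleModel m k) p p) := by
  let T : Fin N → (Fin k → EuclideanSpace ℝ (Fin m)) →L[ℝ] ℝ := fun i =>
    mfderiv (tupleModel m k) 𝓘(ℝ, ℝ) (fun p => S p i) p
  have hT : LinearIndependent ℝ T := hS.independent p hp
  refine ⟨ContinuousLinearMap.pi T, hT.range_pi_eq_top, hasStrictFDerivAt_pi.2 fun i => ?_⟩
  exact ((hS.smooth i).contMDiffAt
    (hS.isOpen.mem_nhds hp)).hasStrictFDerivAt_writtenInExtChartAt

theorem smul_eq (hS : IsCompleteFundamentalSet m G Γ V fun i p => S p i) {p : Fin k → M} {g : G}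
    {h : Equiv.Perm (Fin k)} (hh : h ∈ Γ) (hp : p ∈ V) (hgp : g • permute h p ∈ V) :
    S (g • permute h p) = S p :=
  funext fun i => hS.invariant i g h hh p hp hgp

theorem eq_of_mem_orbit (hS : IsCompleteFundamentalSet m G Γ V fun i p => S p i)
    {p q : Fin k → M} (hp : p ∈ V) (hq : q ∈ V) (h : p ∈ MulAction.orbit G q) : S p = S q := by
  obtain ⟨g, rfl⟩ := h
  exact hS.smul_eq Γ.one_mem hq hp

/-- Near a point of `V`, the level sets of a complete fundamental set of invariants lie in the
orbits. -/
theorem exists_mem_orbit_of_eq [TopologicalSpace G] [ChartedSpace (EuclideanSpace ℝ (Fin r)) G]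
    [ContMDiffSMul (𝓡 r) (𝓡 m) ∞ G M]
    {U : Set (Fin k → M)} (hU : IsOpen U) (hdim : ∀ p ∈ U, orbitDim m r G p + N = m * k)
    (hS : IsCompleteFundamentalSet m G Γ V fun i p => S p i)
    {z : Fin k → M} (hzU : z ∈ U) (hzV : z ∈ V) :
    ∃ W : Set (Fin k → M), IsOpen W ∧ z ∈ W ∧ W ⊆ U ∩ V ∧
      ∀ p ∈ W, ∀ q ∈ W, S p = S q → p ∈ MulAction.orbit G q := by
  obtain ⟨S', hS', hSz⟩ := hS.hasStrictFDerivAt hzV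
  obtain ⟨W, hWsub, hWo, hzW, hW⟩ := exists_isPreconnected_levelSet hSz hS'
    ((hU.inter hS.isOpen).mem_nhds ⟨hzU, hzV⟩)
  refine ⟨W, hWo, hzW, hWsub, fun p hp q hq hpq => ?_⟩
  -- An equivalence relation that holds locally on a connected set holds throughout it; the relation
  -- here is lying in one orbit.
  refine (hW (S q)).induction₂ (fun x y => x ∈ MulAction.orbit G y) (fun x hx => ?_)
    (fun x y z _ _ _ hxy hyz => ?_) (fun x y _ _ hxy => MulAction.mem_orbit_symm.1 hxy)
    ⟨hp, hpq⟩ ⟨hq, rfl⟩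
  · obtain ⟨T', hT', hT⟩ := hS.hasStrictFDerivAt (hWsub hx.1).2
    have hone : (1 : G) • x = x := one_smul G x
    have hcont : Filter.Tendsto (fun g : G => g • x) (𝓝 1) (𝓝 x) := by
      simpa [ContinuousAt] using
        (contMDiff_orbitMap (m := m) (r := r) (G := G) x).continuous.continuousAt (x := 1)
    have hlevel : ∀ᶠ g : G in 𝓝 1, S (g • x) = S ((1 : G) • x) := by
      filter_upwards [hcont (hS.isOpen.mem_nhds (hWsub hx.1).2)] with g hg
      rw [hone]
      exact hS.eq_of_mem_orbit hg (hWsub hx.1).2 ⟨g, rfl⟩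
    have hrank := hdim x (hWsub hx.1).1
    -- The orbit map has rank `s` at `1`, so it covers a neighborhood of `x` in the level set.
    have key := (contMDiff_orbitMap (m := m) (r := r) x (1 : G)).eventually_mem_range_of_eq
      (S := S) (S' := T') (by rw [hone]; exact hT) hT' hlevel (by
        rw [orbitDim] at hrank
        simpa [Module.finrank_pi_fintype, mul_comm] using hrank)
    rw [hone] at key
    filter_upwards [nhdsWithin_le_nhds key, self_mem_nhdsWithin] with y hy hys
    exact MulAction.mem_orbit_symm.1 (hy (hys.2.trans hx.2.symm))
  · rwa [← MulAction.orbit_eq_iff.2 hyz]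

end IsCompleteFundamentalSet

theorem orbitDim_le (m r : ℕ) {k : ℕ} {M : Type*} [TopologicalSpace M]
    [ChartedSpace (EuclideanSpace ℝ (Fin m)) M] (G : Type*) [TopologicalSpace G]
    [ChartedSpace (EuclideanSpace ℝ (Fin r)) G] [Group G] [MulAction G M] (p : Fin k → M) :
    orbitDim m r G p ≤ m * k := by
  have h : Module.finrank ℝ (Fin k → EuclideanSpace ℝ (Fin m)) = m * k := by
    simp [Module.finrank_pi_fintype, mul_comm]
  rw [← h]
  exact Submodule.finrank_le (R := ℝ) (M := Fin k → EuclideanSpace ℝ (Fin m)) _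

/-! ### Classes of tuples and polygon equivalence. -/

section Quotients

omit [TopologicalSpace M] [ChartedSpace (EuclideanSpace ℝ (Fin m)) M]

theorem TupleQuot.mk_eq_iff {p q : Fin k → M} :
    TupleQuot.mk Γ p = TupleQuot.mk Γ q ↔ ∃ h ∈ Γ, permute h p = q :=
  Quotient.eq (r := permSetoid Γ M)

theorem polygon_permute {h : Equiv.Perm (Fin k)} (hh : h ∈ polygonPerms k) (q : Fin k → M) :
    polygon (permute h q) = polygon q :=
  (TupleQuot.mk_eq_iff.2 ⟨h, hh, rfl⟩).symm

theorem polygon_reverseTuple (q : Fin k → M) : polygon (reverseTuple q) = polygon q :=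
  polygon_permute (Subgroup.mem_sup_right (Subgroup.mem_zpowers _)) q

theorem polygon_eq_of_cyclicTuple_eq {p q : Fin k → M} (h : cyclicTuple p = cyclicTuple q) :
    polygon p = polygon q := by
  obtain ⟨c, hc, rfl⟩ := TupleQuot.mk_eq_iff.1 h
  exact (polygon_permute (Subgroup.mem_sup_left hc) p).symm

theorem polygonEquiv_of_mem_orbit {p q : Fin k → M} (h : p ∈ MulAction.orbit G q) :
    PolygonEquiv G (polygon p) (polygon q) := by
  obtain ⟨g, hg⟩ := MulAction.mem_orbit_symm.1 h
  exact ⟨g, congrArg polygon hg⟩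

end Quotients

/-- The value of a complete fundamental set of invariants under `G` and the polygon symmetries only
depends on the `G`-equivalence class of a polygon. -/
theorem IsCompleteFundamentalSet.eq_of_polygonEquiv {V : Set (KGon k M)} {S : KGon k M → Fin N → ℝ}
    (hS : IsCompleteFundamentalSet m G (polygonPerms k) (polygon ⁻¹' V)
      fun i p => S (polygon p) i)
    {p q : Fin k → M} (hp : polygon p ∈ V) (hq : polygon q ∈ V)
    (h : PolygonEquiv G (polygon p) (polygon q)) : S (polygon p) = S (polygon q) := by
  obtain ⟨g, hg⟩ := h
  obtain ⟨c, hc, hcq⟩ := TupleQuot.mk_eq_iff.1 (show polygon (g • p) = polygon q from hg)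
  subst hcq
  exact (hS.smul_eq (S := fun p => S (polygon p)) (g := g) hc hp hq).symm

end Tuples

/-! ### Equivalence of the three signature criteria. -/

theorem mainTheorem4 {m r k s : ℕ}
    {M : Type*} [TopologicalSpace M] [ChartedSpace (EuclideanSpace ℝ (Fin m)) M]
    [IsManifold (𝓡 m) ∞ M]
    {G : Type*} [TopologicalSpace G] [ChartedSpace (EuclideanSpace ℝ (Fin r)) G] [Group G]
    [LieGroup (𝓡 r) ∞ G] [MulAction G M] [ContMDiffSMul (𝓡 r) (𝓡 m) ∞ G M]
    (U : Set (Fin k → M)) (hU : IsOpen U) (hreg : ActsRegularly m r G U s)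
    (z : Fin k → M) (hz : z ∈ U)
    -- the three signatures, defined on neighborhoods of `z` and of its two classes
    (V₁ : Set (Fin k → M)) (S₁ : (Fin k → M) → Fin (m * k - s) → ℝ) (hz₁ : z ∈ V₁)
    (hS₁ : IsCompleteFundamentalSet m G ⊥ V₁ fun i p => S₁ p i)
    (V₂ : Set (CyclicTuple k M)) (S₂ : CyclicTuple k M → Fin (m * k - s) → ℝ)
    (hz₂ : cyclicTuple z ∈ V₂)
    (hS₂ : IsCompleteFundamentalSet m G (cyclicPerms k) (cyclicTuple ⁻¹' V₂)
      fun i p => S₂ (cyclicTuple p) i)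
    (V₃ : Set (KGon k M)) (S₃ : KGon k M → Fin (m * k - s) → ℝ)
    (hz₃ : polygon z ∈ V₃)
    (hS₃ : IsCompleteFundamentalSet m G (polygonPerms k) (polygon ⁻¹' V₃)
      fun i p => S₃ (polygon p) i) :
    -- the equivalences hold on all sufficiently small domains of the signatures
    ∃ W : Set (Fin k → M), IsOpen W ∧ z ∈ W ∧ W ⊆ U ∧
      W ⊆ V₁ ∧ cyclicTuple '' W ⊆ V₂ ∧ polygon '' W ⊆ V₃ ∧
      ∀ (U₁ : Set (Fin k → M)) (U₂ : Set (CyclicTuple k M)) (U₃ : Set (KGon k M)),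
        U₁ ⊆ W → U₂ ⊆ cyclicTuple '' W → U₃ ⊆ polygon '' W →
        ∀ p q : Fin k → M,
          p ∈ U₁ → cyclicTuple p ∈ U₂ → polygon p ∈ U₃ →
          (∃ h ∈ polygonPerms k, permute h q ∈ U₁) →
          (cyclicTuple q ∈ U₂ ∨ cyclicTuple (reverseTuple q) ∈ U₂) →
          polygon q ∈ U₃ →
          (PolygonEquiv G (polygon p) (polygon q) ↔
            ∃ h ∈ polygonPerms k, permute h q ∈ U₁ ∧ S₁ p = S₁ (permute h q)) ∧
          (PolygonEquiv G (polygon p) (polygon q) ↔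
            (cyclicTuple q ∈ U₂ ∧ S₂ (cyclicTuple p) = S₂ (cyclicTuple q)) ∨
            (cyclicTuple (reverseTuple q) ∈ U₂ ∧
              S₂ (cyclicTuple p) = S₂ (cyclicTuple (reverseTuple q)))) ∧
          (PolygonEquiv G (polygon p) (polygon q) ↔ S₃ (polygon p) = S₃ (polygon q)) := by
  -- Ensures that the truncated subtraction `m * k - s` is the true codimension of the orbits.
  have hs : s ≤ m * k := hreg.orbitDim_eq z hz ▸ orbitDim_le m r G z
  have hdim : ∀ p ∈ U, orbitDim m r G p + (m * k - s) = m * k := fun p hp => by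
    rw [hreg.orbitDim_eq p hp]
    omega
  obtain ⟨W₁, hW₁o, hzW₁, hW₁, horb₁⟩ := hS₁.exists_mem_orbit_of_eq hU hdim hz hz₁
  obtain ⟨W₂, hW₂o, hzW₂, hW₂, horb₂⟩ :=
    hS₂.exists_mem_orbit_of_eq (S := fun p => S₂ (cyclicTuple p)) hU hdim hz hz₂
  obtain ⟨W₃, hW₃o, hzW₃, hW₃, horb₃⟩ :=
    hS₃.exists_mem_orbit_of_eq (S := fun p => S₃ (polygon p)) hU hdim hz hz₃
  have hV₃ : ∀ w ∈ W₁ ∩ W₂ ∩ W₃, polygon w ∈ V₃ := fun w hw => (hW₃ hw.2).2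
  refine ⟨W₁ ∩ W₂ ∩ W₃, (hW₁o.inter hW₂o).inter hW₃o, ⟨⟨hzW₁, hzW₂⟩, hzW₃⟩,
    fun w hw => (hW₁ hw.1.1).1, fun w hw => (hW₁ hw.1.1).2,
    image_subset_iff.2 fun w hw => (hW₂ hw.1.2).2, image_subset_iff.2 hV₃, ?_⟩
  intro U₁ U₂ U₃ hU₁ hU₂ hU₃ p q hp _ _ hq₁ hq₂ hq₃
  have hpW := hU₁ hp
  -- The polygon signature removes the permutation: a representative of `Q` in `W` lies in the
  -- `G`-orbit of `p` itself.
  have horbit : ∀ w ∈ W₁ ∩ W₂ ∩ W₃, polygon w = polygon q →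
      PolygonEquiv G (polygon p) (polygon q) → p ∈ MulAction.orbit G w := by
    intro w hw hwq h
    rw [← hwq] at h
    exact horb₃ p hpW.2 w hw.2 (hS₃.eq_of_polygonEquiv (hV₃ p hpW) (hV₃ w hw) h)
  have hcyclic : ∀ q' : Fin k → M, polygon q' = polygon q → cyclicTuple q' ∈ U₂ →
      (PolygonEquiv G (polygon p) (polygon q) ↔ S₂ (cyclicTuple p) = S₂ (cyclicTuple q')) := by
    intro q' hq' hU₂q'
    -- `q'` itself need not lie in `W`; a cyclic rearrangement `w` of it does and has the same
    -- signature.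
    obtain ⟨w, hw, hwq⟩ := hU₂ hU₂q'
    have hwq' : polygon w = polygon q := (polygon_eq_of_cyclicTuple_eq hwq).trans hq'
    rw [← hwq]
    constructor
    · intro h
      exact hS₂.eq_of_mem_orbit (S := fun p => S₂ (cyclicTuple p)) (hW₂ hpW.1.2).2
        (hW₂ hw.1.2).2 (horbit w hw hwq' h)
    · intro h
      exact hwq' ▸ polygonEquiv_of_mem_orbit (horb₂ p hpW.1.2 w hw.1.2 h)
  refine ⟨⟨fun h => ?_, ?_⟩, ⟨fun h => ?_, ?_⟩, ⟨fun h => ?_, fun h => ?_⟩⟩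
  · obtain ⟨c, hc, hcq⟩ := hq₁
    exact ⟨c, hc, hcq, hS₁.eq_of_mem_orbit (hW₁ hpW.1.1).2 (hW₁ (hU₁ hcq).1.1).2
      (horbit _ (hU₁ hcq) (polygon_permute hc q) h)⟩
  · rintro ⟨c, hc, hcq, h⟩
    exact polygon_permute hc q ▸
      polygonEquiv_of_mem_orbit (horb₁ p hpW.1.1 _ (hU₁ hcq).1.1 h)
  · exact hq₂.imp (fun hq => ⟨hq, (hcyclic q rfl hq).1 h⟩)
      fun hq => ⟨hq, (hcyclic _ (polygon_reverseTuple q) hq).1 h⟩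
  · rintro (⟨hq, h⟩ | ⟨hq, h⟩)
    · exact (hcyclic q rfl hq).2 h
    · exact (hcyclic _ (polygon_reverseTuple q) hq).2 h
  · obtain ⟨w, hw, hwq⟩ := hU₃ hq₃
    exact hS₃.eq_of_polygonEquiv (hV₃ p hpW) (hwq ▸ hV₃ w hw) h
  · obtain ⟨w, hw, hwq⟩ := hU₃ hq₃
    rw [← hwq] at h ⊢
    exact polygonEquiv_of_mem_orbit (horb₃ p hpW.2 w hw.2 h)
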